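/- Let $C = 0.55$. For $f:\{-1,1\}^n\to\mathbb{R}$ with Fourier–Walsh expansion $f(x)=\sum_{S\subseteq[n]}\hat f(S)\prod_{i\in S}x_i$, let $\deg f=\max\{|S| : \hat f(S)\ne 0\}$ (with $\deg 0=0$), let $L(f)=\max_{i\in[n]}\sum_{S\ni i}|\hat f(S)|$, let $\xi=\frac{2C}{\sqrt{\deg f}}-2L(f)$ (with $\xi=+\infty$ if $f$ is constant), and let $\mu$ be the Gibbs distribution on $\{-1,1\}^n$, $\mu(x)\propto \exp(f(x))$. A pinning is an assignment $\tau\in\{-1,1\}^\Lambda$ with $\Lambda\subseteq[n]$ (as $\mu$ has full support, every such assignment is feasible). The distribution $\mu$ is $b$-marginally bounded if $\mu(\sigma_v=k\mid\sigma_\Lambda=\tau)\ge b$ for every pinning $\tau$ and all $v\notin\Lambda$, $k\in\{-1,1\}$. The influence matrix $\Psi_\mu^\tau$ is indexed by the pairs $(v,k)$ with $v\in[n]\setminus\Lambda$, $k\in\{-1,1\}$, and has entries $\Psi_\mu^\tau(u,j;v,k)=\mu(\sigma_v=k\mid\sigma_u=j,\sigma_\Lambda=\tau)-\mu(\sigma_v=k\mid\sigma_\Lambda=\tau)$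 if $u\ne v$ and $0$ if $u=v$; its eigenvalues are real. The distribution $\mu$ is $\eta$-spectrally independent if, for every pinning $\tau$, all eigenvalues of $\Psi_\mu^\tau$ are at most $\eta$. Theorem. (1) There is a function $\eta(b,\xi)$ such that for all $n$, all $f:\{-1,1\}^n\to\mathbb{R}$, and all $\epsilon>0$, $b>0$: if $\sqrt{\deg f}\cdot L(f)\le C-\epsilon$ and $\mu$ is $b$-marginally bounded, then $\mu$ is $\eta(b,\xi)$-spectrally independent. (2) In particular, $\mu$ is $O(1)$-spectrally independent if $\epsilon,\deg f,b=\Theta(1)$: for all $\epsilon>0$, $b>0$ and $D\in\mathbb{N}$ there is a constant $\eta$ such that, for all $n$ and all $f:\{-1,1\}^n\to\mathbb{R}$ with $\deg f\le D$ and $\sqrt{\deg f}\cdot L(f)\le C-\epsilon$ whose Gibbs distribution $\mu$ is $b$-marginally bounded, $\mu$ is $\eta$-spectrally independent. -/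

import Mathlib

noncomputable section

namespace CubeGibbs

/-! ## Distributions on `V → Q`, pinnings, influences, spectral independence -/

section General

variable {V Q : Type} [Fintype V] [Fintype Q] [DecidableEq V]

/-- The probability `μ(A)` of an event `A` under a distribution `μ` on a finite set,
given by its mass function. -/
def prob {Ω : Type} [Fintype Ω] (μ : Ω → ℝ) (A : Set Ω) : ℝ :=
  ∑ σ, A.indicator μ σ

/-- The conditional probability `μ(A | B)`; only used when `μ(B) > 0`. -/
def condProb {Ω : Type} [Fintype Ω] (μ : Ω → ℝ) (A B : Set Ω) : ℝ :=
  prob μ (A ∩ B) / prob μ B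

/-- The event `σ_v = k`. -/
def spinEvent (v : V) (k : Q) : Set (V → Q) := {σ | σ v = k}

/-- The event `σ_Λ = τ`. -/
def pinEvent {Λ : Finset V} (τ : Λ → Q) : Set (V → Q) := {σ | ∀ v : Λ, σ v = τ v}

/-- `τ` is a pinning of `μ` on `Λ`: it extends to a configuration of positive weight. -/
def IsPinning (μ : (V → Q) → ℝ) {Λ : Finset V} (τ : Λ → Q) : Prop :=
  ∃ σ, 0 < μ σ ∧ σ ∈ pinEvent τ

/-- The pairs `(v, k)` with `v` an unpinned vertex and `k` a feasible spin at `v` under `τ`. -/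
def feasiblePairs (μ : (V → Q) → ℝ) {Λ : Finset V} (τ : Λ → Q) : Set (V × Q) :=
  {p | p.1 ∉ Λ ∧ ∃ σ, 0 < μ σ ∧ σ ∈ pinEvent τ ∧ σ p.1 = p.2}

/-- The pairwise influence matrix under the pinning `τ`: the entry at `(u, j), (v, k)` is `0` if
`u = v` and `μ(σ_v = k | σ_u = j, σ_Λ = τ) - μ(σ_v = k | σ_Λ = τ)` otherwise. -/
def influenceMatrix (μ : (V → Q) → ℝ) {Λ : Finset V} (τ : Λ → Q) :
    Matrix (feasiblePairs μ τ) (feasiblePairs μ τ) ℝ :=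
  Matrix.of fun p q =>
    if p.1.1 = q.1.1 then 0
    else condProb μ (spinEvent q.1.1 q.1.2) (spinEvent p.1.1 p.1.2 ∩ pinEvent τ) -
      condProb μ (spinEvent q.1.1 q.1.2) (pinEvent τ)

open Classical in
/-- `μ` is spectrally independent with constant `η`: for every pinning, the largest eigenvalue of
the influence matrix (all of whose eigenvalues are real) is at most `η`. -/
def IsSpectrallyIndependent (μ : (V → Q) → ℝ) (η : ℝ) : Prop :=
  ∀ (Λ : Finset V) (τ : Λ → Q), IsPinning μ τ →
    ∀ r : ℝ, Module.End.HasEigenvalue (Matrix.toLin' (influenceMatrix μ τ)) r → r ≤ η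

/-- `μ` is `b`-marginally bounded: `μ(σ_v = k | σ_Λ = τ) ≥ b` for every pinning `τ` and every
pair `(v, k)` feasible under `τ`. -/
def IsMarginallyBounded (μ : (V → Q) → ℝ) (b : ℝ) : Prop :=
  ∀ (Λ : Finset V) (τ : Λ → Q), IsPinning μ τ →
    ∀ p ∈ feasiblePairs μ τ, b ≤ condProb μ (spinEvent p.1 p.2) (pinEvent τ)

end General

/-! ## Fourier analysis on the discrete cube, with `{-1, 1}` realized as `ℤˣ` -/

/-- The discrete cube `{-1, 1}^n`. -/
abbrev Cube (n : ℕ) : Type := Fin n → ℤˣ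

/-- The monomial `∏ i ∈ S, x i`. -/
def walsh {n : ℕ} (S : Finset (Fin n)) (x : Cube n) : ℝ := ∏ i ∈ S, ((x i : ℤ) : ℝ)

/-- The Fourier coefficient `f̂(S) = 2⁻ⁿ ∑ₓ f(x) ∏ i ∈ S, x i`. -/
def walshCoeff {n : ℕ} (f : Cube n → ℝ) (S : Finset (Fin n)) : ℝ :=
  (∑ x, f x * walsh S x) / 2 ^ n

/-- The degree of `f` as a multilinear polynomial (`0` for `f = 0`). -/
def deg {n : ℕ} (f : Cube n → ℝ) : ℕ :=
  sSup {d | ∃ S : Finset (Fin n), walshCoeff f S ≠ 0 ∧ S.card = d}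

/-- `L(f) = max_i ∑_{S ∋ i} |f̂(S)|` (and `0` if there are no coordinates). -/
def lip {n : ℕ} (f : Cube n → ℝ) : ℝ :=
  ⨆ i : Fin n, ∑ S : Finset (Fin n) with i ∈ S, |walshCoeff f S|

/-- The Gibbs distribution `μ(x) ∝ exp (f x)`. -/
def gibbs {n : ℕ} (f : Cube n → ℝ) (x : Cube n) : ℝ :=
  Real.exp (f x) / ∑ y, Real.exp (f y)

/-- The absolute constant `C = 0.55`. -/
def constC : ℝ := 0.55

/-- `ξ = 2C / √(deg f) - 2 L(f)`, which is `+∞` for constant `f`. -/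
def xi {n : ℕ} (f : Cube n → ℝ) : EReal :=
  if deg f = 0 then ⊤ else ((2 * constC / √(deg f : ℝ) - 2 * lip f : ℝ) : EReal)

end CubeGibbs

end

open Finset Function

namespace CubeGibbs

/-! The partition function has no zeros under small complex external fields, so marginals are
bounded analytic functions of the fields. Cauchy's estimate then bounds their derivatives, which are
rows of influences.

Zero-freeness (`signSum_exp_multilin_ne_zero`) is an induction on the set of summed coordinates; the
others range over `[-1, 1]`. Moving coordinate `j` from `1` to `-1` multiplies the partial sum by
`exp w`. If `|w.im| ≤ 2θ`, the two halves of the next sum cancel by at most a factor `cos θ`. A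
monomial of the `j`-derivative involves at most `d - 1` other variables. Splitting the sum along
these costs at most `cos θ ^ (d - 1)`, so the logarithmic derivative is at most `L / cos θ ^ (d -
1)`. With `θ = 1 / √d` and `L ≤ 0.55 / √d` this is at most `θ`, and the induction closes.

A field of size `δ` only adds `δ` to `L`. Letting the field at `u` vary as well bounds the
complexified marginal of `σ_u = j` (`norm_div_add_le_of_forall_ne_zero`). Its derivative in a field
direction `s` at `0` is `μ(σ_u = j)` times an `s`-weighted sum of changes in spin means
(`weight_div_mul_sum_le`). Taking `s` to be the signs and dividing by `b` bounds the absolute row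
sums, hence the eigenvalues (`isSpectrallyIndependent_gibbs`). -/

/-! ## Sums over sub-cubes -/

section SignSum

variable {V : Type*} [DecidableEq V]

/-- The sum of `G` over all points obtained from `y` by setting the coordinates in `A` to `±1`. -/
def signSum {M : Type*} [AddCommMonoid M] (A : Finset V) (G : (V → ℝ) → M) (y : V → ℝ) : M :=
  ∑ T ∈ A.powerset, G (T.piecewise 1 (A.piecewise (-1) y))

theorem signSum_empty {M : Type*} [AddCommMonoid M] (G : (V → ℝ) → M) (y : V → ℝ) :
    signSum ∅ G y = G y := by
  simp [signSum]

theorem signSum_insert {M : Type*} [AddCommMonoid M] {A : Finset V} {i : V} (hi : i ∉ A)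
    (G : (V → ℝ) → M) (y : V → ℝ) :
    signSum (insert i A) G y =
      signSum A G (update y i 1) + signSum A G (update y i (-1)) := by
  unfold signSum
  rw [sum_powerset_insert hi, add_comm]
  congr 1 <;>
  · refine sum_congr rfl fun T hT => congrArg G ?_
    have hiT : i ∉ T := fun h => hi (mem_powerset.1 hT h)
    ext k
    by_cases hk : k = i
    · subst hk; simp [Finset.piecewise, hi, hiT]
    · simp [Finset.piecewise, hk]

theorem signSum_update {M : Type*} [AddCommMonoid M] {A : Finset V} {i : V} (hi : i ∉ A)
    (G : (V → ℝ) → M) (y : V → ℝ) (t : ℝ) :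
    signSum A G (update y i t) =
      ∑ T ∈ A.powerset, G (update (T.piecewise 1 (A.piecewise (-1) y)) i t) := by
  refine sum_congr rfl fun T hT => congrArg G ?_
  have hiT : i ∉ T := fun h => hi (mem_powerset.1 hT h)
  ext k
  by_cases hk : k = i
  · subst hk; simp [Finset.piecewise, hi, hiT]
  · simp [Finset.piecewise, hk]

theorem signSum_union {M : Type*} [AddCommMonoid M] {B C : Finset V} (h : Disjoint B C)
    (G : (V → ℝ) → M) (y : V → ℝ) :
    signSum (B ∪ C) G y = signSum B (signSum C G) y := by
  induction B using Finset.induction_on generalizing y with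
  | empty => simp [signSum_empty]
  | insert i B hi ih =>
    rw [disjoint_insert_left] at h
    rw [insert_union, signSum_insert (by simp [hi, h.1]), signSum_insert hi, ih h.2, ih h.2]

theorem norm_signSum_le (A : Finset V) (G : (V → ℝ) → ℂ) (y : V → ℝ) :
    ‖signSum A G y‖ ≤ signSum A (fun z => ‖G z‖) y :=
  norm_sum_le _ _

theorem abs_piecewise_le_one {A T : Finset V} {y : V → ℝ} (hy : ∀ i, |y i| ≤ 1) (i : V) :
    |T.piecewise (1 : V → ℝ) (A.piecewise (-1) y) i| ≤ 1 := by
  by_cases h1 : i ∈ T <;> by_cases h2 : i ∈ A <;> simp [Finset.piecewise, h1, h2, hy]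

theorem abs_update_le_one {y : V → ℝ} (hy : ∀ i, |y i| ≤ 1) {t : ℝ} (ht : |t| ≤ 1) (i k : V) :
    |update y i t k| ≤ 1 := by
  by_cases h : k = i
  · subst h; simpa
  · simpa [h] using hy k

theorem signSum_le_signSum {A : Finset V} {G H : (V → ℝ) → ℝ}
    (h : ∀ z : V → ℝ, (∀ i, |z i| ≤ 1) → G z ≤ H z) {y : V → ℝ} (hy : ∀ i, |y i| ≤ 1) :
    signSum A G y ≤ signSum A H y :=
  sum_le_sum fun _ _ => h _ (abs_piecewise_le_one hy)

/-- If every partial sum dominates `κ` times the sum of the norms of its two halves, then it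
dominates `κ ^ |B|` times the sum of norms obtained by splitting along all of `B`. -/
theorem pow_mul_signSum_norm_le {A : Finset V} {G : (V → ℝ) → ℂ} {κ : ℝ} (hκ : 0 ≤ κ)
    (h : ∀ (B : Finset V) (j : V), j ∉ B → insert j B ⊆ A → ∀ y : V → ℝ, (∀ i, |y i| ≤ 1) →
      κ * (‖signSum B G (update y j 1)‖ + ‖signSum B G (update y j (-1))‖) ≤
        ‖signSum (insert j B) G y‖)
    {B C : Finset V} (hBC : Disjoint B C) (hA : B ∪ C ⊆ A) {y : V → ℝ} (hy : ∀ i, |y i| ≤ 1) :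
    κ ^ #B * signSum B (fun z => ‖signSum C G z‖) y ≤ ‖signSum (B ∪ C) G y‖ := by
  induction B using Finset.induction_on generalizing y with
  | empty => simp [signSum_empty]
  | insert i B hi ih =>
    rw [disjoint_insert_left] at hBC
    rw [insert_union] at hA
    rw [insert_union, signSum_insert hi, card_insert_of_notMem hi]
    refine le_trans ?_ (h (B ∪ C) i (by simp [hi, hBC.1]) hA y hy)
    have hA' := (subset_insert i (B ∪ C)).trans hA
    have h1 := ih hBC.2 hA' (abs_update_le_one hy (t := 1) (by simp) i)
    have h2 := ih hBC.2 hA' (abs_update_le_one hy (t := -1) (by simp) i)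
    calc _ = κ * (κ ^ #B * signSum B (fun z => ‖signSum C G z‖) (update y i 1) +
          κ ^ #B * signSum B (fun z => ‖signSum C G z‖) (update y i (-1))) := by ring
      _ ≤ _ := by gcongr

/-- Summing over `A \ S` first makes the monomial a constant of modulus at most `1`, so the triangle
inequality is only spent on `A ∩ S`. -/
theorem norm_signSum_monomial_mul_le (A S : Finset V) (G : (V → ℝ) → ℂ) {y : V → ℝ}
    (hy : ∀ i, |y i| ≤ 1) :
    ‖signSum A (fun z => (∏ j ∈ S, (z j : ℂ)) * G z) y‖ ≤
      signSum (A ∩ S) (fun z => ‖signSum (A \ S) G z‖) y := by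
  have hd : Disjoint (A ∩ S) (A \ S) := by
    rw [Finset.disjoint_left]; intro a; simp +contextual
  have hu : A ∩ S ∪ A \ S = A := by ext a; simp; tauto
  rw [← hu, signSum_union hd, hu]
  refine (norm_signSum_le _ _ _).trans (signSum_le_signSum (fun z hz => ?_) hy)
  have : signSum (A \ S) (fun z => (∏ j ∈ S, (z j : ℂ)) * G z) z =
      (∏ j ∈ S, (z j : ℂ)) * signSum (A \ S) G z := by
    unfold signSum
    rw [mul_sum]
    refine sum_congr rfl fun T hT => ?_
    refine congrArg (· * _) (prod_congr rfl fun j hj => ?_)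
    have h1 : j ∉ A \ S := by simp [hj]
    have h2 : j ∉ T := fun h => h1 (mem_powerset.1 hT h)
    rw [Finset.piecewise_eq_of_notMem _ _ _ h2, Finset.piecewise_eq_of_notMem _ _ _ h1]
  rw [this, norm_mul]
  refine mul_le_of_le_one_left (norm_nonneg _) ?_
  rw [norm_prod]
  exact prod_le_one (fun _ _ => norm_nonneg _) fun j _ => by simpa using hz j

end SignSum

/-! ## Two elementary estimates -/

/-- For `r = ‖exp w‖` and `y = w.im / 2`, the identity is `‖1 + exp w‖² - cos² y (1 + r)² = sin² y
(1 - r)²`. -/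
theorem cos_mul_le_norm_one_add_exp {w : ℂ} {θ : ℝ} (hw : |w.im| ≤ 2 * θ) (hθ : θ ≤ Real.pi / 2) :
    Real.cos θ * (1 + ‖Complex.exp w‖) ≤ ‖1 + Complex.exp w‖ := by
  obtain ⟨x, y, rfl⟩ : ∃ x y : ℝ, w = 2 * (x + y * Complex.I) :=
    ⟨w.re / 2, w.im / 2, by apply Complex.ext <;> simp <;> ring⟩
  have hy : |y| ≤ θ := by
    have : |2 * y| ≤ 2 * θ := by simpa using hw
    rw [abs_mul, abs_two] at this
    linarith
  have hcos : Real.cos θ ≤ Real.cos y := by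
    rw [← Real.cos_abs y]
    exact Real.cos_le_cos_of_nonneg_of_le_pi (abs_nonneg y) (by linarith [Real.pi_pos]) hy
  have hcy : 0 ≤ Real.cos y := Real.cos_nonneg_of_neg_pi_div_two_le_of_le
    (by linarith [(abs_le.1 hy).1]) (by linarith [(abs_le.1 hy).2])
  have hn : ‖Complex.exp (2 * (x + y * Complex.I))‖ = Real.exp x * Real.exp x := by
    rw [Complex.norm_exp, ← Real.exp_add]; simp; ring
  have hs : 1 + Complex.exp (2 * (x + y * Complex.I)) =
      ((1 + Real.exp (2 * x) * Real.cos (2 * y) : ℝ) : ℂ) +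
        ((Real.exp (2 * x) * Real.sin (2 * y) : ℝ) : ℂ) * Complex.I := by
    have : 2 * ((x : ℂ) + y * Complex.I) = ((2 * x : ℝ) : ℂ) + ((2 * y : ℝ) : ℂ) * Complex.I := by
      push_cast; ring
    rw [this, Complex.exp_add, Complex.exp_mul_I]
    push_cast; ring
  rw [hn]
  refine (mul_le_mul_of_nonneg_right hcos (by positivity)).trans ?_
  refine abs_le_of_sq_le_sq' ?_ (norm_nonneg _) |>.2
  rw [hs, Complex.sq_norm, Complex.normSq_add_mul_I, Real.cos_two_mul, Real.sin_two_mul, two_mul x,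
    Real.exp_add]
  have h1 := Real.sin_sq_add_cos_sq y
  have : (1 + Real.exp x * Real.exp x * (2 * Real.cos y ^ 2 - 1)) ^ 2 +
      (Real.exp x * Real.exp x * (2 * Real.sin y * Real.cos y)) ^ 2 -
      (Real.cos y * (1 + Real.exp x * Real.exp x)) ^ 2 =
      Real.sin y ^ 2 * (1 - Real.exp x * Real.exp x) ^ 2 := by
    linear_combination (4 * (Real.exp x * Real.exp x) ^ 2 * Real.cos y ^ 2 -
      (1 - Real.exp x * Real.exp x) ^ 2) * h1
  nlinarith [mul_nonneg (sq_nonneg (Real.sin y)) (sq_nonneg (1 - Real.exp x * Real.exp x))]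

/-- The source of `0.55`: since `cos x ≥ 1 - x² / 2`, the power is at least `(1 - 1 / (2d)) ^ (d -
1) ≥ exp (-1/2) ≥ 1 / 1.8`. -/
theorem constC_le_cos_pow {d : ℕ} (hd : 1 ≤ d) : constC ≤ Real.cos (1 / √(d : ℝ)) ^ (d - 1) := by
  have hd' : (1 : ℝ) ≤ d := by exact_mod_cast hd
  have hc : 1 - 1 / (2 * (d : ℝ)) ≤ Real.cos (1 / √(d : ℝ)) := by
    have := Real.one_sub_sq_div_two_le_cos (x := 1 / √(d : ℝ))
    rw [div_pow, Real.sq_sqrt (by linarith)] at this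
    convert this using 2
    field_simp
  have hpos : 0 < 1 - 1 / (2 * (d : ℝ)) := by
    rw [sub_pos, div_lt_one (by linarith)]; linarith
  refine le_trans ?_ (pow_le_pow_left₀ hpos.le hc _)
  have h2 : (0 : ℝ) < 2 * d - 1 := by linarith
  have hinv : 1 - 1 / (2 * (d : ℝ)) = (1 + 1 / (2 * (d : ℝ) - 1))⁻¹ := by
    field_simp; ring
  have he : (1 + 1 / (2 * (d : ℝ) - 1)) ^ (d - 1) ≤ Real.exp (1 / 2) := by
    have h3 : 1 + 1 / (2 * (d : ℝ) - 1) ≤ Real.exp (1 / (2 * (d : ℝ) - 1)) := by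
      linarith [Real.add_one_le_exp (1 / (2 * (d : ℝ) - 1))]
    refine (pow_le_pow_left₀ (by positivity) h3 _).trans ?_
    rw [← Real.exp_nat_mul]
    refine Real.exp_le_exp.2 ?_
    rw [Nat.cast_sub hd, Nat.cast_one, mul_one_div, div_le_div_iff₀ h2 (by norm_num)]
    linarith
  have he2 : Real.exp (1 / 2) ≤ 1.8 := by
    have h4 : Real.exp (1 / 2) ^ 2 = Real.exp 1 := by rw [← Real.exp_nat_mul]; norm_num
    refine abs_le_of_sq_le_sq' ?_ (by norm_num) |>.2
    rw [h4]; linarith [Real.exp_one_lt_d9]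
  rw [hinv, inv_pow, le_inv_comm₀ (by norm_num [constC]) (by positivity)]
  refine (he.trans he2).trans (by norm_num [constC])

/-- A nonvanishing path whose logarithmic derivative is at most `K` on `[-1, 1]` has endpoints
differing by a factor `exp w` with `‖w‖ ≤ 2 K`. -/
theorem exists_exp_of_norm_logDeriv_le {Z Z' : ℝ → ℂ} {K : ℝ} (hd : ∀ t, HasDerivAt Z (Z' t) t)
    (hc : Continuous Z') (h0 : ∀ t, |t| ≤ 1 → Z t ≠ 0)
    (hK : ∀ t, |t| ≤ 1 → ‖Z' t‖ ≤ K * ‖Z t‖) :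
    ∃ w : ℂ, ‖w‖ ≤ 2 * K ∧ Z (-1) = Z 1 * Complex.exp w := by
  have hZ : Continuous Z := continuous_iff_continuousAt.2 fun t => (hd t).continuousAt
  -- Clamping to `[-1, 1]` makes `Z' / Z` continuous on the whole line, so its primitive `W` is
  -- differentiable everywhere.
  set c : ℝ → ℝ := fun t => max (-1) (min 1 t)
  have hcc : Continuous c := by fun_prop
  have hc1 : ∀ t, |c t| ≤ 1 := fun t => abs_le.2 ⟨le_max_left _ _, max_le (by norm_num)
    (min_le_left _ _)⟩
  have hcid : ∀ t ∈ Set.Icc (-1 : ℝ) 1, c t = t := fun t ht => by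
    simp [c, ht.1, ht.2]
  set q : ℝ → ℂ := fun t => Z' (c t) / Z (c t)
  have hq : Continuous q := (hc.comp hcc).div (hZ.comp hcc) fun t => h0 _ (hc1 t)
  set W : ℝ → ℂ := fun t => ∫ s in (-1 : ℝ)..t, q s
  have hW : ∀ t, HasDerivAt W (q t) t := fun t =>
    intervalIntegral.integral_hasDerivAt_right (hq.intervalIntegrable _ _)
      (hq.stronglyMeasurableAtFilter _ _) hq.continuousAt
  have hconst : Z 1 * Complex.exp (-W 1) = Z (-1) * Complex.exp (-W (-1)) := by
    have hder : ∀ t, HasDerivAt (fun t => Z t * Complex.exp (-W t))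
        (Z' t * Complex.exp (-W t) + Z t * (Complex.exp (-W t) * -q t)) t := fun t =>
      (hd t).mul (hW t).neg.cexp
    refine constant_of_has_deriv_right_zero (f := fun t => Z t * Complex.exp (-W t))
      (a := -1) (b := 1) (fun t _ => (hder t).continuousAt.continuousWithinAt) (fun t ht => ?_) 1
      (by simp)
    have h := (hder t).hasDerivWithinAt (s := Set.Ici t)
    have hz := h0 t (abs_le.2 ⟨ht.1, ht.2.le⟩)
    convert h using 1
    simp only [q, hcid t ⟨ht.1, ht.2.le⟩]
    field_simp
    ring
  refine ⟨-W 1, ?_, ?_⟩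
  · rw [norm_neg]
    have := intervalIntegral.norm_integral_le_of_norm_le_const (a := (-1 : ℝ)) (b := 1) (f := q)
      (C := K) fun t _ => by
        rw [norm_div, div_le_iff₀ (norm_pos_iff.2 (h0 _ (hc1 t)))]
        exact hK _ (hc1 t)
    refine this.trans (le_of_eq ?_)
    norm_num; ring
  · rw [hconst]; simp [W]

/-! ## Zero-freeness of partition functions of low-degree polynomials -/

section ZeroFree

variable {V : Type*} [DecidableEq V] [Fintype V]

/-- The multilinear polynomial `∑ S, a S ∏ i ∈ S, y i`. -/
def multilin (a : Finset V → ℂ) (y : V → ℝ) : ℂ := ∑ S, a S * ∏ i ∈ S, (y i : ℂ)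

/-- The derivative of `multilin a` in the `i`-th variable. -/
def multilinDeriv (a : Finset V → ℂ) (i : V) (y : V → ℝ) : ℂ :=
  ∑ S : Finset V with i ∈ S, a S * ∏ j ∈ S.erase i, (y j : ℂ)

theorem hasDerivAt_multilin_update (a : Finset V → ℂ) (i : V) (y : V → ℝ) (t : ℝ) :
    HasDerivAt (fun t : ℝ => multilin a (update y i t)) (multilinDeriv a i (update y i t)) t := by
  unfold multilin multilinDeriv
  rw [sum_filter]
  refine HasDerivAt.fun_sum fun S _ => ?_
  have key : ∀ s : ℝ, ∏ j ∈ S.erase i, ((update y i s j : ℝ) : ℂ) = ∏ j ∈ S.erase i, (y j : ℂ) :=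
    fun s => prod_congr rfl fun j hj => by rw [update_of_ne (ne_of_mem_erase hj)]
  split_ifs with hi
  · simp_rw [← mul_prod_erase S _ hi, key, update_self]
    simpa using ((Complex.ofRealCLM.hasDerivAt (x := t)).mul_const
      (∏ j ∈ S.erase i, (y j : ℂ))).const_mul (a S)
  · rw [erase_eq_of_notMem hi] at key
    simp_rw [key]
    exact hasDerivAt_const _ _

theorem hasDerivAt_signSum_exp (a : Finset V → ℂ) {A : Finset V} {i : V} (hi : i ∉ A)
    (y : V → ℝ) (t : ℝ) :
    HasDerivAt (fun t : ℝ => signSum A (fun z => Complex.exp (multilin a z)) (update y i t))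
      (signSum A (fun z => multilinDeriv a i z * Complex.exp (multilin a z)) (update y i t)) t := by
  simp_rw [signSum_update hi]
  refine HasDerivAt.fun_sum fun T _ => ?_
  rw [mul_comm]
  exact (hasDerivAt_multilin_update a i _ t).cexp

theorem continuous_signSum_deriv (a : Finset V → ℂ) {A : Finset V} {i : V} (hi : i ∉ A)
    (y : V → ℝ) :
    Continuous fun t : ℝ =>
      signSum A (fun z => multilinDeriv a i z * Complex.exp (multilin a z)) (update y i t) := by
  simp_rw [signSum_update hi]
  unfold multilin multilinDeriv
  refine continuous_finsetSum _ fun T _ => ?_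
  have h : ∀ (z : V → ℝ) (j : V), Continuous fun t : ℝ => ((update z i t j : ℝ) : ℂ) := fun z j =>
    Complex.continuous_ofReal.comp ((continuous_apply j).comp
      ((continuous_const (y := z)).update i continuous_id) :)
  refine Continuous.mul ?_ (Complex.continuous_exp.comp ?_)
  · exact continuous_finsetSum _ fun S _ =>
      continuous_const.mul (continuous_finsetProd _ fun j _ => h _ j)
  · exact continuous_finsetSum _ fun S _ =>
      continuous_const.mul (continuous_finsetProd _ fun j _ => h _ j)

/-- The derivative is bounded monomial by monomial: `norm_signSum_monomial_mul_le` splits the sum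
along the monomial's variables, and `pow_mul_signSum_norm_le` recombines the pieces at a cost of one
`κ` per variable. -/
theorem norm_signSum_deriv_le {a : Finset V → ℂ} {d : ℕ} (ha : ∀ S, d < #S → a S = 0)
    {l κ : ℝ} (hκ : 0 < κ) (hκ1 : κ ≤ 1) {i : V}
    (hl : ∑ S : Finset V with i ∈ S, ‖a S‖ ≤ l) {A : Finset V} {G : (V → ℝ) → ℂ}
    (h : ∀ (B : Finset V) (j : V), j ∉ B → insert j B ⊆ A → ∀ y : V → ℝ, (∀ i, |y i| ≤ 1) →
      κ * (‖signSum B G (update y j 1)‖ + ‖signSum B G (update y j (-1))‖) ≤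
        ‖signSum (insert j B) G y‖)
    {y : V → ℝ} (hy : ∀ i, |y i| ≤ 1) :
    ‖signSum A (fun z => multilinDeriv a i z * G z) y‖ ≤
      l / κ ^ (d - 1) * ‖signSum A G y‖ := by
  have hsum : signSum A (fun z => multilinDeriv a i z * G z) y =
      ∑ S : Finset V with i ∈ S,
        a S * signSum A (fun z => (∏ j ∈ S.erase i, (z j : ℂ)) * G z) y := by
    simp only [signSum, multilinDeriv, sum_mul, mul_sum]
    rw [sum_comm]
    simp only [mul_assoc]
  rw [hsum]
  calc _ ≤ ∑ S : Finset V with i ∈ S, ‖a S‖ * (‖signSum A G y‖ / κ ^ (d - 1)) := by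
        refine norm_sum_le_of_le _ fun S hS => ?_
        rw [norm_mul]
        by_cases hSd : d < #S
        · simp [ha S hSd]
        refine mul_le_mul_of_nonneg_left ?_ (norm_nonneg _)
        rw [le_div_iff₀ (by positivity), mul_comm]
        refine (mul_le_mul_of_nonneg_left (norm_signSum_monomial_mul_le A _ G hy)
          (by positivity)).trans ?_
        have hd : Disjoint (A ∩ S.erase i) (A \ S.erase i) := by
          rw [Finset.disjoint_left]; intro a; simp +contextual
        have hu : A ∩ S.erase i ∪ A \ S.erase i = A := by ext a; simp; tauto
        have := pow_mul_signSum_norm_le hκ.le h hd hu.subset hy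
        rw [hu] at this
        refine le_trans (mul_le_mul_of_nonneg_right ?_ (sum_nonneg fun _ _ => norm_nonneg _)) this
        refine pow_le_pow_of_le_one hκ.le hκ1 ?_
        have h1 : #(S.erase i) = #S - 1 := card_erase_of_mem (by simpa using hS)
        have h2 := card_le_card (inter_subset_right (s₁ := A) (s₂ := S.erase i))
        omega
    _ = (∑ S : Finset V with i ∈ S, ‖a S‖) * (‖signSum A G y‖ / κ ^ (d - 1)) := by rw [sum_mul]
    _ ≤ l * (‖signSum A G y‖ / κ ^ (d - 1)) := by gcongr
    _ = _ := by ring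

/-- Zero-freeness: `∑ exp (multilin a)` over any sub-cube does not vanish when the degree and
the Lipschitz constant of `multilin a` satisfy `√d * L ≤ 0.55`. -/
theorem signSum_exp_multilin_ne_zero {a : Finset V → ℂ} {d : ℕ} (hd : 1 ≤ d)
    (ha : ∀ S, d < #S → a S = 0)
    (hl : ∀ i, ∑ S : Finset V with i ∈ S, ‖a S‖ ≤ constC / √(d : ℝ))
    (A : Finset V) {y : V → ℝ} (hy : ∀ i, |y i| ≤ 1) :
    signSum A (fun z => Complex.exp (multilin a z)) y ≠ 0 := by
  set G : (V → ℝ) → ℂ := fun z => Complex.exp (multilin a z) with hG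
  set θ : ℝ := 1 / √(d : ℝ) with hθ
  have hd' : (1 : ℝ) ≤ d := by exact_mod_cast hd
  have hsq : 1 ≤ √(d : ℝ) := Real.one_le_sqrt.2 hd'
  have hθ1 : θ ≤ 1 := by rw [hθ, div_le_one (by linarith)]; exact hsq
  have hθ0 : 0 < θ := by positivity
  have hκ : 0 < Real.cos θ := Real.cos_pos_of_mem_Ioo
    ⟨by linarith [Real.pi_pos], by linarith [Real.pi_gt_three]⟩
  -- The two claims feed each other: the inequality for smaller sets gives nonvanishing on `A`,
  -- which allows integrating the logarithmic derivative and so yields the inequality for `A`.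
  suffices H : (∀ y : V → ℝ, (∀ i, |y i| ≤ 1) → signSum A G y ≠ 0) ∧
      ∀ j ∉ A, ∀ y : V → ℝ, (∀ i, |y i| ≤ 1) →
        Real.cos θ * (‖signSum A G (update y j 1)‖ + ‖signSum A G (update y j (-1))‖) ≤
          ‖signSum (insert j A) G y‖ from H.1 y hy
  clear hy y
  induction A using Finset.strongInduction with
  | H A ih =>
    have hne : ∀ y : V → ℝ, (∀ i, |y i| ≤ 1) → signSum A G y ≠ 0 := by
      intro y hy
      rcases A.eq_empty_or_nonempty with rfl | ⟨j, hj⟩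
      · simp [signSum_empty, hG]
      · obtain ⟨h1, h2⟩ := ih (A.erase j) (erase_ssubset hj)
        have h3 := h2 j (notMem_erase j A) y hy
        rw [insert_erase hj] at h3
        have h4 := norm_pos_iff.2 (h1 _ (abs_update_le_one hy (t := 1) (by simp) j))
        refine norm_pos_iff.1 (lt_of_lt_of_le ?_ h3)
        positivity
    refine ⟨hne, fun j hj y hy => ?_⟩
    obtain ⟨w, hw, hw2⟩ := exists_exp_of_norm_logDeriv_le (K := θ)
      (fun t => hasDerivAt_signSum_exp a hj y t) (continuous_signSum_deriv a hj y)
      (fun t ht => hne _ (abs_update_le_one hy ht j)) (fun t ht => by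
        have hyt := abs_update_le_one hy ht j
        refine (norm_signSum_deriv_le ha hκ (Real.cos_le_one _) (hl j) ?_ hyt).trans ?_
        · intro B k hk hB
          exact (ih B (ssubset_iff.2 ⟨k, hk, hB⟩)).2 k hk
        · refine mul_le_mul_of_nonneg_right ?_ (norm_nonneg _)
          rw [div_le_iff₀ (by positivity), hθ, div_mul_eq_mul_div, one_mul]
          exact div_le_div_of_nonneg_right (constC_le_cos_pow hd) (by positivity))
    have h2 := cos_mul_le_norm_one_add_exp ((Complex.abs_im_le_norm w).trans hw)
      (by linarith [Real.pi_gt_three])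
    rw [signSum_insert hj]
    simp only [← hG] at hw2
    rw [hw2, norm_mul]
    calc _ = ‖signSum A G (update y j 1)‖ * (Real.cos θ * (1 + ‖Complex.exp w‖)) := by ring
      _ ≤ ‖signSum A G (update y j 1)‖ * ‖1 + Complex.exp w‖ := by gcongr
      _ = _ := by rw [← norm_mul, mul_add, mul_one]

end ZeroFree

/-! ## Fourier inversion on the cube -/

section Fourier

variable {n : ℕ}

/-- A point of the cube as a real vector. -/
def toReal (σ : Cube n) (i : Fin n) : ℝ := ((σ i : ℤ) : ℝ)

theorem abs_toReal (σ : Cube n) (i : Fin n) : |toReal σ i| = 1 := by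
  rcases Int.units_eq_one_or (σ i) with h | h <;> simp [toReal, h]

/-- The sum factors as `∏ i, (1 + y i * x i)`. -/
theorem sum_walsh_mul_walsh (x y : Cube n) :
    ∑ S, walsh S y * walsh S x = if y = x then 2 ^ n else 0 := by
  simp only [walsh, ← prod_mul_distrib]
  rw [← powerset_univ, ← prod_one_add]
  split_ifs with h
  · subst h
    have : ∀ i, 1 + ((y i : ℤ) : ℝ) * ((y i : ℤ) : ℝ) = 2 := fun i => by
      rcases Int.units_eq_one_or (y i) with h | h <;> simp [h] <;> norm_num
    simp [this]
  · obtain ⟨i, hi⟩ := Function.ne_iff.1 h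
    refine prod_eq_zero (mem_univ i) ?_
    rcases Int.units_eq_one_or (y i) with h1 | h1 <;>
      rcases Int.units_eq_one_or (x i) with h2 | h2 <;> simp_all

theorem sum_walshCoeff_mul_walsh (f : Cube n → ℝ) (x : Cube n) :
    ∑ S, walshCoeff f S * walsh S x = f x := by
  simp only [walshCoeff, div_mul_eq_mul_div, sum_mul]
  rw [← sum_div, sum_comm, div_eq_iff (by positivity)]
  simp only [mul_assoc, ← mul_sum, sum_walsh_mul_walsh]
  simp

theorem walshCoeff_eq_zero_of_deg_lt {f : Cube n → ℝ} {S : Finset (Fin n)} (h : deg f < #S) :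
    walshCoeff f S = 0 := by
  by_contra hS
  refine h.not_ge (le_csSup ⟨n, ?_⟩ ⟨S, hS, rfl⟩)
  rintro _ ⟨T, -, rfl⟩
  simpa using card_le_univ T

theorem sum_abs_walshCoeff_le_lip (f : Cube n → ℝ) (i : Fin n) :
    ∑ S : Finset (Fin n) with i ∈ S, |walshCoeff f S| ≤ lip f :=
  le_ciSup (f := fun i : Fin n => ∑ S : Finset (Fin n) with i ∈ S, |walshCoeff f S|)
    (Set.finite_range _).bddAbove i

theorem lip_eq_zero_of_deg_eq_zero {f : Cube n → ℝ} (h : deg f = 0) : lip f = 0 := by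
  have : ∀ i : Fin n, ∑ S : Finset (Fin n) with i ∈ S, |walshCoeff f S| = 0 := fun i =>
    sum_eq_zero fun S hS => by
      rw [walshCoeff_eq_zero_of_deg_lt (h ▸ card_pos.2 ⟨i, (mem_filter.1 hS).2⟩), abs_zero]
  simp [lip, this]

end Fourier

/-! ## Zero-freeness of the Gibbs partition function under complex external fields -/

section Fields

variable {n : ℕ}

theorem signSum_eq_sum_filter {M : Type*} [AddCommMonoid M] (A : Finset (Fin n))
    (G : (Fin n → ℝ) → M) (ρ : Cube n) :
    signSum A G (toReal ρ) = ∑ σ : Cube n with ∀ i ∉ A, σ i = ρ i, G (toReal σ) := by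
  refine sum_bij' (fun T _ i => if i ∈ T then 1 else if i ∈ A then -1 else ρ i)
    (fun σ _ => A.filter fun i => σ i = 1) ?_ ?_ ?_ ?_ ?_
  · intro T hT
    refine mem_filter.2 ⟨mem_univ _, fun i hi => ?_⟩
    have : i ∉ T := fun h => hi (mem_powerset.1 hT h)
    simp [this, hi]
  · intro σ _
    simp
  · intro T hT
    ext i
    have hTA : i ∈ T → i ∈ A := fun h => mem_powerset.1 hT h
    by_cases h1 : i ∈ T
    · simp [h1, hTA h1]
    · by_cases h2 : i ∈ A <;> simp [h1, h2]
  · intro σ hσ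
    ext i
    have := (mem_filter.1 hσ).2 i
    by_cases h2 : i ∈ A
    · rcases Int.units_eq_one_or (σ i) with h | h <;> simp [h2, h]
    · simp [h2, this h2]
  · intro T hT
    congr 1
    ext i
    by_cases h1 : i ∈ T
    · simp [h1, toReal]
    · by_cases h2 : i ∈ A <;> simp [h1, h2, toReal]

theorem sum_exp_add_field_ne_zero {f : Cube n → ℝ} {d : ℕ} (hd : 1 ≤ d) (hf : deg f ≤ d) {δ : ℝ}
    (hδ : lip f + δ ≤ constC / √(d : ℝ)) {h : Fin n → ℂ} (hh : ∀ i, ‖h i‖ ≤ δ)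
    (A : Finset (Fin n)) (ρ : Cube n) :
    ∑ σ : Cube n with ∀ i ∉ A, σ i = ρ i, Complex.exp (f σ + ∑ v, h v * toReal σ v) ≠ 0 := by
  -- The field enters as degree-one coefficients; `1 ≤ d` keeps them within the degree bound.
  set a : Finset (Fin n) → ℂ := fun S => walshCoeff f S + ∑ v, if S = {v} then h v else 0 with ha
  have hF : ∀ σ : Cube n, (f σ : ℂ) + ∑ v, h v * toReal σ v = multilin a (toReal σ) := by
    intro σ
    simp only [multilin, ha, add_mul, sum_add_distrib, sum_mul]
    congr 1
    · rw [← sum_walshCoeff_mul_walsh f σ]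
      push_cast [walsh, toReal]
      rfl
    · rw [sum_comm]
      simp [ite_mul]
  simp_rw [hF]
  rw [← signSum_eq_sum_filter A (fun z => Complex.exp (multilin a z)) ρ]
  refine signSum_exp_multilin_ne_zero hd (fun S hS => ?_) (fun i => ?_) A
    fun i => (abs_toReal ρ i).le
  · have h1 : ∀ v, S ≠ {v} := fun v hv => by rw [hv, card_singleton] at hS; omega
    simp [ha, walshCoeff_eq_zero_of_deg_lt (hf.trans_lt hS), h1]
  · refine le_trans ?_ hδ
    calc _ ≤ ∑ S : Finset (Fin n) with i ∈ S, (|walshCoeff f S| +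
          ∑ v, if S = {v} then ‖h v‖ else 0) := by
          refine sum_le_sum fun S _ => (norm_add_le _ _).trans ?_
          rw [Complex.norm_real, Real.norm_eq_abs]
          gcongr
          refine norm_sum_le_of_le _ fun v _ => ?_
          split_ifs <;> simp
      _ ≤ lip f + δ := by
          rw [sum_add_distrib]
          refine add_le_add (sum_abs_walshCoeff_le_lip f i) (le_trans (le_of_eq ?_) (hh i))
          rw [sum_comm]
          simp [sum_ite_eq']

end Fields

/-! ## From zero-freeness to bounded derivatives of marginals -/

theorem norm_div_add_le_of_forall_ne_zero {p q : ℂ} {δ : ℝ} (hδ : 0 < δ)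
    (h : ∀ z : ℂ, ‖z‖ ≤ δ → p * Complex.exp z + q * Complex.exp (-z) ≠ 0) :
    ‖p / (p + q)‖ ≤ 1 / min (1 / 2) δ := by
  have hc : 0 < min (1 / 2) δ := by positivity
  rcases eq_or_ne p 0 with rfl | hp
  · simp [hδ.le]
  by_contra! hlt
  have h0 : p + q ≠ 0 := by simpa using h 0 (by simpa using hδ.le)
  have hx : ‖(p + q) / p‖ < min (1 / 2) δ := by
    rw [← inv_div, norm_inv, inv_lt_comm₀ ((one_div_pos.2 hc).trans hlt) hc]
    simpa using hlt
  set x := (p + q) / p with hxdef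
  have hl := Complex.norm_log_one_add_half_le_self (z := -x)
    (by rw [norm_neg]; exact hx.le.trans (min_le_left _ _))
  rw [norm_neg] at hl
  have hne : 1 + -x ≠ 0 := by
    intro h1
    have : x = 1 := by linear_combination -h1
    rw [this, norm_one] at hx
    linarith [min_le_left (1 / 2) δ]
  -- A zero needs `exp (2z) = -q / p = 1 - x`. For small `x` this root has `‖z‖ ≤ 3/4 * ‖x‖ < δ`.
  refine h (Complex.log (1 + -x) / 2) ?_ ?_
  · rw [norm_div, Complex.norm_two]
    linarith [min_le_right (1 / 2) δ, norm_nonneg x]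
  · have he := Complex.exp_log hne
    set l := Complex.log (1 + -x)
    have h2 : Complex.exp (l / 2) = Complex.exp (-(l / 2)) * Complex.exp l := by
      rw [← Complex.exp_add]; congr 1; ring
    rw [h2, he, hxdef]
    field_simp
    ring

section Derivative

variable {n : ℕ}

/-- The partition function over `X` with the real external field `s` scaled by `t`. -/
noncomputable def fieldSum (f : Cube n → ℝ) (s : Fin n → ℝ) (X : Finset (Cube n)) (t : ℂ) : ℂ :=
  ∑ σ ∈ X, Complex.exp (f σ + t * ∑ v, s v * toReal σ v)

theorem hasDerivAt_fieldSum (f : Cube n → ℝ) (s : Fin n → ℝ) (X : Finset (Cube n)) (t : ℂ) :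
    HasDerivAt (fieldSum f s X)
      (∑ σ ∈ X, Complex.exp (f σ + t * ∑ v, s v * toReal σ v) * ∑ v, s v * toReal σ v) t := by
  refine HasDerivAt.fun_sum fun σ _ => ?_
  have := (((hasDerivAt_id t).mul_const (∑ v, (s v : ℂ) * toReal σ v)).const_add (f σ : ℂ)).cexp
  simpa using this

/-- The weight of a set of configurations. -/
noncomputable def weight (f : Cube n → ℝ) (X : Finset (Cube n)) : ℝ := ∑ σ ∈ X, Real.exp (f σ)

/-- The unnormalized mean of the `v`-th spin over a set of configurations. -/
noncomputable def moment (f : Cube n → ℝ) (X : Finset (Cube n)) (v : Fin n) : ℝ :=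
  ∑ σ ∈ X, Real.exp (f σ) * toReal σ v

theorem weight_pos (f : Cube n → ℝ) {X : Finset (Cube n)} (hX : X.Nonempty) : 0 < weight f X :=
  sum_pos (fun _ _ => Real.exp_pos _) hX

theorem fieldSum_zero (f : Cube n → ℝ) (s : Fin n → ℝ) (X : Finset (Cube n)) :
    fieldSum f s X 0 = weight f X := by
  simp [fieldSum, weight]

theorem hasDerivAt_fieldSum_zero (f : Cube n → ℝ) (s : Fin n → ℝ) (X : Finset (Cube n)) :
    HasDerivAt (fieldSum f s X) ((∑ v, s v * moment f X v : ℝ) : ℂ) 0 := by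
  convert hasDerivAt_fieldSum f s X 0 using 1
  simp only [moment, mul_sum]
  rw [sum_comm]
  push_cast
  refine sum_congr rfl fun σ _ => ?_
  rw [mul_sum]
  refine sum_congr rfl fun v _ => ?_
  rw [zero_mul, add_zero]
  ring

variable {f : Cube n → ℝ} {d : ℕ} {δ : ℝ} {s : Fin n → ℝ} {A : Finset (Fin n)} {u : Fin n}

theorem norm_fieldSum_div_le (hd : 1 ≤ d) (hf : deg f ≤ d) (hδ0 : 0 < δ)
    (hδ : lip f + δ ≤ constC / √(d : ℝ)) (hs : ∀ v, |s v| ≤ 1) (hsu : s u = 0)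
    (ρ : Cube n) (j : ℤˣ) {t : ℂ} (ht : ‖t‖ ≤ δ) :
    ‖fieldSum f s {σ | (∀ i ∉ A, σ i = ρ i) ∧ σ u = j} t /
      fieldSum f s {σ | ∀ i ∉ A, σ i = ρ i} t‖ ≤ 1 / min (1 / 2) δ := by
  classical
  have hsplit : fieldSum f s {σ | ∀ i ∉ A, σ i = ρ i} t =
      fieldSum f s {σ | (∀ i ∉ A, σ i = ρ i) ∧ σ u = j} t +
        fieldSum f s {σ | (∀ i ∉ A, σ i = ρ i) ∧ ¬ σ u = j} t := by
    unfold fieldSum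
    rw [← filter_filter, ← filter_filter, sum_filter_add_sum_filter_not]
  rw [hsplit]
  refine norm_div_add_le_of_forall_ne_zero hδ0 fun z hz => ?_
  -- This field weights `σ u = j` by `exp z` and the opposite spin by `exp (-z)`. As `s u = 0`, the
  -- field at `u` is free and still has norm at most `δ`.
  set h : Fin n → ℂ := fun v => if v = u then z * ((j : ℤ) : ℂ) else t * s v with hh
  have hj : ‖((j : ℤ) : ℂ)‖ = 1 := by
    rcases Int.units_eq_one_or j with h | h <;> simp [h]
  have hb : ∀ v, ‖h v‖ ≤ δ := fun v => by
    simp only [hh]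
    split_ifs
    · rw [norm_mul, hj, mul_one]; exact hz
    · rw [norm_mul, Complex.norm_real, Real.norm_eq_abs]
      exact (mul_le_of_le_one_right (norm_nonneg _) (hs v)).trans ht
  have hsum : ∀ σ : Cube n, ∑ v, h v * toReal σ v =
      t * ∑ v, s v * toReal σ v + z * ((j : ℤ) : ℂ) * toReal σ u := by
    intro σ
    push_cast
    rw [mul_sum, ← add_sum_erase _ _ (mem_univ u),
      ← add_sum_erase _ (fun v => t * ((s v : ℂ) * toReal σ v)) (mem_univ u), hsu, add_comm]
    simp only [hh, if_true, Complex.ofReal_zero, zero_mul, mul_zero, zero_add]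
    congr 1
    refine sum_congr rfl fun v hv => ?_
    rw [if_neg (ne_of_mem_erase hv), mul_assoc]
  have key := sum_exp_add_field_ne_zero hd hf hδ hb A ρ
  rw [← sum_filter_add_sum_filter_not _ (fun σ => σ u = j), filter_filter, filter_filter] at key
  convert key using 2 <;>
  · unfold fieldSum
    rw [sum_mul]
    refine sum_congr rfl fun σ hσ => ?_
    have hσ := (mem_filter.1 hσ).2.2
    rw [hsum, ← Complex.exp_add, add_assoc]
    congr 3
    rcases Int.units_eq_one_or j with h | h <;>
      rcases Int.units_eq_one_or (σ u) with h' | h' <;> simp_all [toReal]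

/-- The left side is the derivative at `0` of `fieldSum f s Y t / fieldSum f s X t`; Cauchy's
estimate on the disc of radius `δ` bounds it. -/
theorem weight_div_mul_sum_le (hd : 1 ≤ d) (hf : deg f ≤ d) (hδ0 : 0 < δ)
    (hδ : lip f + δ ≤ constC / √(d : ℝ)) (hs : ∀ v, |s v| ≤ 1) (hsu : s u = 0)
    {ρ : Cube n} {j : ℤˣ} (hρ : ρ u = j) {X Y : Finset (Cube n)}
    (hX : X = ({σ | ∀ i ∉ A, σ i = ρ i} : Finset (Cube n)))
    (hY : Y = ({σ | (∀ i ∉ A, σ i = ρ i) ∧ σ u = j} : Finset (Cube n))) :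
    weight f Y / weight f X *
      ∑ v, s v * (moment f Y v / weight f Y - moment f X v / weight f X) ≤
        1 / (min (1 / 2) δ * δ) := by
  have hXp : 0 < weight f X := weight_pos f ⟨ρ, by simp [hX]⟩
  have hYp : 0 < weight f Y := weight_pos f ⟨ρ, by simp [hY, hρ]⟩
  have hne : ∀ t : ℂ, ‖t‖ ≤ δ → fieldSum f s X t ≠ 0 := fun t ht => by
    have := sum_exp_add_field_ne_zero hd hf hδ (h := fun v => t * s v) (fun v => by
      rw [norm_mul, Complex.norm_real, Real.norm_eq_abs]
      exact (mul_le_of_le_one_right (norm_nonneg _) (hs v)).trans ht) A ρ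
    rw [hX]
    simpa only [fieldSum, mul_sum, mul_assoc, Complex.ofReal_sum, Complex.ofReal_mul] using this
  have hdiff : DifferentiableOn ℂ (fun t => fieldSum f s Y t / fieldSum f s X t)
      (closure (Metric.ball 0 δ)) := by
    rw [closure_ball _ hδ0.ne']
    intro t ht
    exact ((hasDerivAt_fieldSum f s Y t).differentiableAt.div
      (hasDerivAt_fieldSum f s X t).differentiableAt
      (hne t (by simpa using ht))).differentiableWithinAt
  have hC := Complex.norm_deriv_le_of_forall_mem_sphere_norm_le hδ0 hdiff.diffContOnCl
    (C := 1 / min (1 / 2) δ) fun t ht => by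
      rw [hX, hY]
      exact norm_fieldSum_div_le hd hf hδ0 hδ hs hsu ρ j (by simpa using (mem_sphere_iff_norm.1 ht).le)
  have hder := ((hasDerivAt_fieldSum_zero f s Y).div (hasDerivAt_fieldSum_zero f s X)
    (hne 0 (by simpa using hδ0.le))).deriv
  rw [fieldSum_zero, fieldSum_zero] at hder
  change deriv (fun t => fieldSum f s Y t / fieldSum f s X t) 0 = _ at hder
  rw [hder, div_div] at hC
  refine le_trans (le_trans (le_of_eq ?_) (le_abs_self (((∑ v, s v * moment f Y v) * weight f X -
    weight f Y * ∑ v, s v * moment f X v) / weight f X ^ 2))) (le_trans (le_of_eq ?_) hC)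
  · have : ∑ v, s v * (moment f Y v / weight f Y - moment f X v / weight f X) =
        (∑ v, s v * moment f Y v) / weight f Y - (∑ v, s v * moment f X v) / weight f X := by
      simp only [sum_div, ← sum_sub_distrib]
      exact sum_congr rfl fun v _ => by ring
    rw [this]
    field_simp
  · rw [← Real.norm_eq_abs, ← Complex.norm_real]
    push_cast
    rfl

end Derivative

/-! ## Influences and spectral independence -/

section Influence

theorem condProb_gibbs {n : ℕ} (f : Cube n → ℝ) {A B : Set (Cube n)} {X Y : Finset (Cube n)}
    (hX : ∀ σ, σ ∈ X ↔ σ ∈ A ∩ B) (hY : ∀ σ, σ ∈ Y ↔ σ ∈ B) :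
    condProb (gibbs f) A B = weight f X / weight f Y := by
  classical
  have h : ∀ (B : Set (Cube n)) (Y : Finset (Cube n)), (∀ σ, σ ∈ Y ↔ σ ∈ B) →
      prob (gibbs f) B = weight f Y / ∑ y, Real.exp (f y) := fun B Y hY => by
    have hYB : Y = ({σ | σ ∈ B} : Finset (Cube n)) := by ext σ; simp [hY]
    simp only [hYB, prob, weight, sum_filter, sum_div, Set.indicator, gibbs, ite_div, zero_div]
  have hpos : 0 < ∑ y, Real.exp (f y) := sum_pos (fun _ _ => Real.exp_pos _) univ_nonempty
  rw [condProb, h _ X hX, h _ Y hY, div_div_div_cancel_right₀ hpos.ne']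

/-- The indicator of `σ v = k` is `(1 + k * σ v) / 2`, so influences reduce to differences of spin
means. -/
theorem condProb_spinEvent {n : ℕ} (f : Cube n → ℝ) {B : Set (Cube n)} {Y : Finset (Cube n)}
    (hY : ∀ σ, σ ∈ Y ↔ σ ∈ B) (hne : Y.Nonempty) (v : Fin n) (k : ℤˣ) :
    condProb (gibbs f) (spinEvent v k) B =
      (1 + ((k : ℤ) : ℝ) * (moment f Y v / weight f Y)) / 2 := by
  have hpos : 0 < weight f Y := weight_pos f hne
  have h : weight f {σ ∈ Y | σ v = k} =
      (weight f Y + ((k : ℤ) : ℝ) * moment f Y v) / 2 := by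
    simp only [weight, moment, mul_sum, ← sum_add_distrib, sum_div, sum_filter]
    refine sum_congr rfl fun σ _ => ?_
    rcases Int.units_eq_one_or k with h | h <;>
      rcases Int.units_eq_one_or (σ v) with h' | h' <;> simp [toReal, h, h']
  rw [condProb_gibbs f (X := {σ ∈ Y | σ v = k}) (fun σ => by simp [hY, spinEvent, and_comm]) hY, h]
  field_simp

/-- Gershgorin's theorem, with all discs centred at `0`. -/
theorem hasEigenvalue_le_of_row_sum_le {ι : Type*} {_ : Fintype ι} {_ : DecidableEq ι}
    {M : Matrix ι ι ℝ} {r K : ℝ} (hr : Module.End.HasEigenvalue (Matrix.toLin' M) r)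
    (hdiag : ∀ p, M p p = 0) (hrow : ∀ p, ∑ q, ‖M p q‖ ≤ K) : r ≤ K := by
  obtain ⟨p, hp⟩ := eigenvalue_mem_ball hr
  rw [hdiag, mem_closedBall_zero_iff, Real.norm_eq_abs] at hp
  exact (le_abs_self r).trans (hp.trans ((sum_le_sum_of_subset_of_nonneg (erase_subset _ _)
    fun _ _ _ => norm_nonneg _).trans (hrow p)))

theorem isSpectrallyIndependent_gibbs {n : ℕ} {f : Cube n → ℝ} {d : ℕ} {δ b : ℝ} (hd : 1 ≤ d)
    (hf : deg f ≤ d) (hδ0 : 0 < δ) (hδ : lip f + δ ≤ constC / √(d : ℝ)) (hb : 0 < b)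
    (hμ : IsMarginallyBounded (gibbs f) b) :
    IsSpectrallyIndependent (gibbs f) (1 / (min (1 / 2) δ * δ) / b) := by
  classical
  intro Λ τ hτ r hr
  refine hasEigenvalue_le_of_row_sum_le hr (fun p => by simp [influenceMatrix]) ?_
  rintro ⟨⟨u, j⟩, hp⟩
  obtain ⟨huΛ, ρ, -, hρτ, hρu⟩ := id hp
  simp only at huΛ hρu
  set X : Finset (Cube n) := {σ | σ ∈ pinEvent τ} with hX
  set Y : Finset (Cube n) := {σ | σ ∈ spinEvent u j ∩ pinEvent τ} with hY
  have hXmem : ∀ σ, σ ∈ X ↔ σ ∈ pinEvent τ := by simp [hX]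
  have hYmem : ∀ σ, σ ∈ Y ↔ σ ∈ spinEvent u j ∩ pinEvent τ := by simp [hY]
  set m : Fin n → ℝ := fun v => moment f Y v / weight f Y - moment f X v / weight f X with hm
  have hD : ∀ v k, condProb (gibbs f) (spinEvent v k) (spinEvent u j ∩ pinEvent τ) -
      condProb (gibbs f) (spinEvent v k) (pinEvent τ) = ((k : ℤ) : ℝ) * m v / 2 := fun v k => by
    rw [condProb_spinEvent f hYmem ⟨ρ, (hYmem ρ).2 ⟨hρu, hρτ⟩⟩,
      condProb_spinEvent f hXmem ⟨ρ, (hXmem ρ).2 hρτ⟩]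
    simp only [hm]
    ring
  have hent : ∀ q : feasiblePairs (gibbs f) τ, ‖influenceMatrix (gibbs f) τ ⟨(u, j), hp⟩ q‖ =
      if u = q.1.1 then 0 else |m q.1.1| / 2 := fun q => by
    simp only [influenceMatrix, Matrix.of_apply]
    split_ifs
    · simp
    · rw [hD, Real.norm_eq_abs, abs_div, abs_mul]
      rcases Int.units_eq_one_or q.1.2 with h | h <;> simp [h]
  -- These signs turn `∑ v, s v * m v` into `∑ |m v|` over `v ≠ u`. The two spins at `v` contribute
  -- `|m v| / 2` each to the row.
  set s : Fin n → ℝ := fun v => if u = v then 0 else SignType.sign (m v) with hs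
  have hpin : ∀ σ : Cube n, σ ∈ pinEvent τ ↔ ∀ i ∉ Λᶜ, σ i = ρ i := by
    intro σ
    constructor
    · intro h i hi
      rw [mem_compl, not_not] at hi
      exact (h ⟨i, hi⟩).trans (hρτ ⟨i, hi⟩).symm
    · intro h i
      exact (h i (by simp)).trans (hρτ i)
  have hmain := weight_div_mul_sum_le (f := f) (s := s) (u := u) (A := Λᶜ) hd hf hδ0 hδ
    (fun v => by
      simp only [hs]
      split_ifs
      · simp
      · rcases lt_trichotomy (m v) 0 with h | h | h <;> simp [h])
    (by simp [hs]) hρu (X := X) (Y := Y) (by ext σ; simp [hX, hpin])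
    (by ext σ; simp [hY, hpin, spinEvent, and_comm])
  have hbound : b ≤ weight f Y / weight f X := by
    have := hμ Λ τ hτ _ hp
    rwa [condProb_gibbs f hYmem hXmem] at this
  have hrow : ∑ q, ‖influenceMatrix (gibbs f) τ ⟨(u, j), hp⟩ q‖ ≤ ∑ v, s v * m v := by
    calc _ = ∑ q ∈ univ.map (Embedding.subtype (· ∈ feasiblePairs (gibbs f) τ)),
          if u = q.1 then 0 else |m q.1| / 2 := by
          rw [sum_map]
          exact sum_congr rfl fun q _ => hent q
      _ ≤ ∑ q : Fin n × ℤˣ, if u = q.1 then 0 else |m q.1| / 2 :=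
          sum_le_sum_of_subset_of_nonneg (subset_univ _) fun _ _ _ => by split_ifs <;> positivity
      _ = ∑ v, s v * m v := by
          rw [Fintype.sum_prod_type]
          refine sum_congr rfl fun v _ => ?_
          simp only [hs, sum_const]
          split_ifs
          · simp
          · rw [sign_mul_self, card_univ, Fintype.card_units_int]
            simp [mul_div_cancel₀]
  refine hrow.trans ?_
  rw [le_div_iff₀ hb, mul_comm]
  refine le_trans (mul_le_mul_of_nonneg_right hbound ?_) hmain
  exact (sum_nonneg fun _ _ => norm_nonneg _).trans hrow

end Influence

end CubeGibbs

open CubeGibbs in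
theorem mainTheorem11 :
    (∃ η : ℝ → EReal → ℝ, ∀ (n : ℕ) (f : CubeGibbs.Cube n → ℝ) (ε b : ℝ), 0 < ε → 0 < b →
      √(CubeGibbs.deg f : ℝ) * CubeGibbs.lip f ≤ CubeGibbs.constC - ε →
      CubeGibbs.IsMarginallyBounded (CubeGibbs.gibbs f) b →
      CubeGibbs.IsSpectrallyIndependent (CubeGibbs.gibbs f) (η b (CubeGibbs.xi f))) ∧
    (∀ (ε b : ℝ) (D : ℕ), 0 < ε → 0 < b →
      ∃ η : ℝ, ∀ (n : ℕ) (f : CubeGibbs.Cube n → ℝ),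
        CubeGibbs.deg f ≤ D →
        √(CubeGibbs.deg f : ℝ) * CubeGibbs.lip f ≤ CubeGibbs.constC - ε →
        CubeGibbs.IsMarginallyBounded (CubeGibbs.gibbs f) b →
        CubeGibbs.IsSpectrallyIndependent (CubeGibbs.gibbs f) η) := by
  have hC : 0 < constC := by norm_num [constC]
  have hgap : ∀ {n : ℕ} {f : Cube n → ℝ} {ε : ℝ}, deg f ≠ 0 →
      √(deg f : ℝ) * lip f ≤ constC - ε → lip f + ε / √(deg f : ℝ) ≤ constC / √(deg f : ℝ) := by
    intro n f ε h0 h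
    have : 0 < √(deg f : ℝ) := Real.sqrt_pos.2 (by exact_mod_cast Nat.pos_of_ne_zero h0)
    rw [← le_sub_iff_add_le, ← sub_div, le_div_iff₀ this, mul_comm]
    exact h
  constructor
  -- The available field size is `δ = ξ / 2 = C / √(deg f) - L(f)`; `ε` only ensures that it is
  -- positive. For constant `f`, `d = 1` and `L = 0` allow `δ = C`.
  · refine ⟨fun b ξ => if ξ = ⊤ then 1 / (min (1 / 2) constC * constC) / b else
      1 / (min (1 / 2) (ξ.toReal / 2) * (ξ.toReal / 2)) / b, fun n f ε b hε hb h hμ => ?_⟩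
    rcases eq_or_ne (deg f) 0 with h0 | h0
    · simp only [xi, h0, if_true]
      exact isSpectrallyIndependent_gibbs le_rfl (h0.trans_le zero_le_one) hC
        (by simp [lip_eq_zero_of_deg_eq_zero h0]) hb hμ
    · have hpos : 0 < ε / √(deg f : ℝ) :=
        div_pos hε (Real.sqrt_pos.2 (by exact_mod_cast Nat.pos_of_ne_zero h0))
      have hξ : (2 * constC / √(deg f : ℝ) - 2 * lip f) / 2 = constC / √(deg f : ℝ) - lip f := by
        ring
      simp only [xi, h0, if_false, EReal.coe_ne_top, EReal.toReal_coe, hξ]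
      exact isSpectrallyIndependent_gibbs (Nat.one_le_iff_ne_zero.2 h0) le_rfl
        (by linarith [hgap h0 h]) (by linarith) hb hμ
  · intro ε b D hε hb
    -- A uniform `δ`: `ε / √D` serves nonconstant `f`, the minimum with `C` covers constant `f`, and
    -- `max D 1` avoids dividing by zero.
    have hD : 0 < ε / √(max D 1 : ℕ) := div_pos hε (Real.sqrt_pos.2 (by simp))
    refine ⟨1 / (min (1 / 2) (min constC (ε / √(max D 1 : ℕ))) *
      min constC (ε / √(max D 1 : ℕ))) / b, fun n f hfD h hμ => ?_⟩
    rcases eq_or_ne (deg f) 0 with h0 | h0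
    · exact isSpectrallyIndependent_gibbs le_rfl (h0.trans_le zero_le_one) (lt_min hC hD)
        (by simp [lip_eq_zero_of_deg_eq_zero h0]) hb hμ
    · refine isSpectrallyIndependent_gibbs (Nat.one_le_iff_ne_zero.2 h0) le_rfl (lt_min hC hD)
        (le_trans ?_ (hgap h0 h)) hb hμ
      have hpos : (0 : ℝ) < √(deg f : ℝ) :=
        Real.sqrt_pos.2 (by exact_mod_cast Nat.pos_of_ne_zero h0)
      gcongr
      refine (min_le_right _ _).trans ?_
      gcongr
      exact hfD.trans (le_max_left _ _)
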